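/- Consider a network with $K$ cells. Base station $k$ has $M_k$ transmit antennas, power budget $P_k$, and serves $I_k$ users; user $i_k$ (the $i$-th user of cell $k$) has $N_{i_k}$ receive antennas, $d_{i_k}$ data streams, noise variance $\sigma_{i_k}^2>0$ and channels $H_{i_k\ell}\in\mathbb{C}^{N_{i_k}\times M_\ell}$. Let $\mathcal{I}\neq\emptyset$ be the set of all users, and $\mathcal{I}_k$ the set of users of cell $k$. For $V=(V_{i_k})$ with $V_{i_k}\in\mathbb{C}^{M_k\times d_{i_k}}$ and $U=(U_{i_k})$ with $U_{i_k}\in\mathbb{C}^{N_{i_k}\times d_{i_k}}$ put $$R_{i_k}(V)=\log\det\Big(I+H_{i_kk}V_{i_k}V_{i_k}^HH_{i_kk}^H\Big(\sigma_{i_k}^2I+\sum_{m_\ell\ne i_k}H_{i_k\ell}V_{m_\ell}V_{m_\ell}^HH_{i_k\ell}^H\Big)^{-1}\Big),$$ $$E_{i_k}(U,V)=(I-U_{i_k}^HH_{i_kk}V_{i_k})(I-U_{i_k}^HH_{i_kk}V_{i_k})^H+\sum_{m_\ell\ne i_k}U_{i_k}^HH_{i_k\ell}V_{m_\ell}V_{m_\ell}^HH_{i_k\ell}^HU_{i_k}+\sigma_{i_k}^2U_{i_k}^HU_{i_k},$$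 $$\Psi_{i_k}(V)=\Big(\sum_{m_\ell\in\mathcal I}H_{i_k\ell}V_{m_\ell}V_{m_\ell}^HH_{i_k\ell}^H+\sigma_{i_k}^2I\Big)^{-1}H_{i_kk}V_{i_k},\qquad \Upsilon_{i_k}(V)=\big(I-V_{i_k}^HH_{i_kk}^H\Psi_{i_k}(V)\big)^{-1},$$ and let $\mathcal{V}$ be the set of all $V$ with $\sum_{i_k\in\mathcal{I}_k}\mathrm{Tr}(V_{i_k}V_{i_k}^H)\le P_k$ for all $k$. Let $(V^n,U^n,W^n)_{n\ge 0}$ be any sequence generated by the alternating algorithm: $V^0\in\mathcal{V}$, $U^0$ is arbitrary, $W^0$ is a tuple of Hermitian positive definite matrices $W^0_{i_k}\in\mathbb{C}^{d_{i_k}\times d_{i_k}}$, and for all $n\ge 0$ $$V^{n+1}\in\arg\min_{V\in\mathcal{V}}\ \max_{i_k\in\mathcal{I}}\ \mathrm{Tr}[W^n_{i_k}E_{i_k}(U^n,V)]-\log\det(W^n_{i_k})-d_{i_k},\qquad U^{n+1}=\Psi(V^{n+1}),\qquad W^{n+1}=\Upsilon(V^{n+1}).$$ Consider the max-min problem in the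 form $$\text{(P1)}\qquad \max_{V,\lambda}\ \lambda\quad\text{s.t.}\quad R_{i_k}(V)\ge\lambda\ \ \forall i_k\in\mathcal{I},\qquad \sum_{i_k\in\mathcal{I}_k}\mathrm{Tr}(V_{i_k}V_{i_k}^H)\le P_k\ \ \forall k,$$ and let $\mathcal{S}$ be the set of its KKT points: all $V$ for which there are $\lambda\in\mathbb{R}$ and multipliers $\mu_{i_k},\epsilon_k\ge 0$ such that the constraints hold, $\sum_{i_k}\mu_{i_k}=1$, $\mu_{i_k}(R_{i_k}(V)-\lambda)=0$ for all $i_k$, $\epsilon_k(P_k-\sum_{i_k\in\mathcal{I}_k}\mathrm{Tr}(V_{i_k}V_{i_k}^H))=0$ for all $k$, and the gradient in $V$ (with respect to real and imaginary parts) of $\sum_{i_k}\mu_{i_k}R_{i_k}(V)-\sum_k\epsilon_k\sum_{i_k\in\mathcal{I}_k}\mathrm{Tr}(V_{i_k}V_{i_k}^H)$ vanishes. Then $\mathcal{S}\neq\emptyset$ and $$\lim_{n\to\infty}d(V^n,\mathcal{S})=0,\qquad d(V,\mathcal{S})=\inf_{V'\in\mathcal{S}}\|V-V'\|,\quad \|V\|^2=\sum_{i_k}\mathrm{Tr}(V_{i_k}V_{i_k}^H).$$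 Moreover, every cluster point of $(V^n)$ belongs to $\mathcal{S}$, i.e. is a stationary point of the max-min problem. -/

import Mathlib

open scoped Matrix Topology ComplexOrder
open Filter

-- Matrices carry the Frobenius norm.
attribute [local instance] Matrix.frobeniusNormedAddCommGroup Matrix.frobeniusNormedSpace

/-- A downlink MIMO multicell network (interfering broadcast channel). Users are the pairs
`⟨k, i⟩` (the `i`-th user of cell `k`). -/
structure Network where
  /-- number of cells -/
  numCells : ℕ
  /-- number of users in each cell -/
  numUsers : Fin numCells → ℕ
  /-- number of transmit antennas of each base station -/
  txAnt : Fin numCells → ℕ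
  /-- number of receive antennas of each user -/
  rxAnt : (Σ k : Fin numCells, Fin (numUsers k)) → ℕ
  /-- number of data streams of each user -/
  streams : (Σ k : Fin numCells, Fin (numUsers k)) → ℕ
  /-- channel from base station `l` to user `i` -/
  channel : ∀ (i : Σ k : Fin numCells, Fin (numUsers k)) (l : Fin numCells),
    Matrix (Fin (rxAnt i)) (Fin (txAnt l)) ℂ
  /-- noise standard deviation at each user -/
  noise : (Σ k : Fin numCells, Fin (numUsers k)) → ℝ
  noise_pos : ∀ i, 0 < noise i
  /-- power budget of each base station -/
  budget : Fin numCells → ℝ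

namespace Network

/-- The set of all users. -/
abbrev User (S : Network) : Type := Σ k : Fin S.numCells, Fin (S.numUsers k)

/-- Tuples `V = (V_i)` of transmit beamformers, one matrix for each user, with the norm
`‖V‖² = ∑ i, Tr (V_i V_iᴴ)`. -/
abbrev Tx (S : Network) : Type :=
  PiLp 2 (fun i : S.User => Matrix (Fin (S.txAnt i.1)) (Fin (S.streams i)) ℂ)

/-- Tuples `U = (U_i)` of receive beamformers. -/
abbrev Rx (S : Network) : Type :=
  ∀ i : S.User, Matrix (Fin (S.rxAnt i)) (Fin (S.streams i)) ℂ

/-- Tuples `W = (W_i)` of weight matrices. -/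
abbrev Weights (S : Network) : Type :=
  ∀ i : S.User, Matrix (Fin (S.streams i)) (Fin (S.streams i)) ℂ

variable (S : Network)

/-- Covariance at user `i` of the signal intended for user `j`:
`H_{i,l} V_j V_jᴴ H_{i,l}ᴴ`, where `l` is the cell of `j`. -/
noncomputable def sigCov (V : S.Tx) (i j : S.User) :
    Matrix (Fin (S.rxAnt i)) (Fin (S.rxAnt i)) ℂ :=
  S.channel i j.1 * V j * (V j)ᴴ * (S.channel i j.1)ᴴ

/-- Noise covariance `σ_i² I`. -/
noncomputable def noiseCov (i : S.User) : Matrix (Fin (S.rxAnt i)) (Fin (S.rxAnt i)) ℂ :=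
  ((S.noise i : ℂ) ^ 2) • 1

/-- The rate of user `i`, treating interference as noise. (The determinant is a real number
`≥ 1`.) -/
noncomputable def rate (V : S.Tx) (i : S.User) : ℝ :=
  Real.log (1 + S.sigCov V i i *
    (S.noiseCov i + ∑ j ∈ Finset.univ.erase i, S.sigCov V i j)⁻¹).det.re

/-- The mean squared error matrix `E_i(U_i, V)`. -/
noncomputable def mse (U : S.Rx)
    (V : S.Tx) (i : S.User) : Matrix (Fin (S.streams i)) (Fin (S.streams i)) ℂ :=
  (1 - (U i)ᴴ * S.channel i i.1 * V i) * (1 - (U i)ᴴ * S.channel i i.1 * V i)ᴴ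
    + ∑ j ∈ Finset.univ.erase i, (U i)ᴴ * S.sigCov V i j * U i
    + ((S.noise i : ℂ) ^ 2) • ((U i)ᴴ * U i)

/-- Transmit power `∑ i ∈ I_k, Tr (V_i V_iᴴ)` of base station `k`. -/
noncomputable def power (V : S.Tx) (k : Fin S.numCells) : ℝ :=
  ∑ i : Fin (S.numUsers k), (V ⟨k, i⟩ * (V ⟨k, i⟩)ᴴ).trace.re

/-- The set of beamformers that satisfy all power budgets. -/
def feasible : Set S.Tx := {V | ∀ k, S.power V k ≤ S.budget k}

/-- The MMSE receivers `Ψ(V)`. -/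
noncomputable def mmse (V : S.Tx) : S.Rx := fun i =>
  (∑ j, S.sigCov V i j + S.noiseCov i)⁻¹ * S.channel i i.1 * V i

/-- The inverse MSE matrices `Υ(V)` under the MMSE receivers. -/
noncomputable def invMse (V : S.Tx) : S.Weights := fun i =>
  (1 - (V i)ᴴ * (S.channel i i.1)ᴴ * S.mmse V i)⁻¹

/-- The objective `max_i Tr (W_i E_i(U_i, V)) - log det W_i - d_i`. (For Hermitian positive
definite `W_i`, the trace and the determinant are real.) -/
noncomputable def objective (U : S.Rx) (W : S.Weights) (V : S.Tx) : ℝ :=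
  ⨆ i, ((W i * S.mse U V i).trace.re - Real.log (W i).det.re - (S.streams i : ℝ))

/-- `Φ(U, W)`: the set of all optimal solutions of the subproblem
`min_V max_i Tr (W_i E_i(U_i, V)) - log det W_i - d_i` over the feasible `V`. -/
def argminTx (U : S.Rx) (W : S.Weights) : Set S.Tx :=
  {V | V ∈ S.feasible ∧ IsMinOn (S.objective U W) S.feasible V}

/-- `(V n, U n, W n)` is a sequence of iterates of the alternating algorithm. -/
structure IsRun (V : ℕ → S.Tx) (U : ℕ → S.Rx) (W : ℕ → S.Weights) : Prop where
  init_feasible : V 0 ∈ S.feasible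
  init_posDef : ∀ i, (W 0 i).PosDef
  step_V : ∀ n, V (n + 1) ∈ S.argminTx (U n) (W n)
  step_U : ∀ n, U (n + 1) = S.mmse (V (n + 1))
  step_W : ∀ n, W (n + 1) = S.invMse (V (n + 1))

/-- The Lagrangian of the problem (P1) of maximizing `t` subject to `t ≤ R_i(V)` for all users `i`
and to the power budgets. -/
noncomputable def lagrangian (mu : S.User → ℝ) (eps : Fin S.numCells → ℝ) (t : ℝ) (V : S.Tx) : ℝ :=
  t + ∑ i, mu i * (S.rate V i - t) + ∑ k, eps k * (S.budget k - S.power V k)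

/-- `(t, V)` is a KKT point of (P1), with multipliers `mu` and `eps`. The gradient in `V` is taken
with respect to real and imaginary parts. -/
structure IsKKTWith (mu : S.User → ℝ) (eps : Fin S.numCells → ℝ) (t : ℝ) (V : S.Tx) : Prop where
  /-- the gradient of the Lagrangian in `V` is zero -/
  grad_V : HasFDerivAt (S.lagrangian mu eps t) (0 : S.Tx →L[ℝ] ℝ) V
  /-- the derivative of the Lagrangian in `t` is zero -/
  grad_t : ∑ i, mu i = 1
  mu_nonneg : ∀ i, 0 ≤ mu i
  rate_ge : ∀ i, t ≤ S.rate V i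
  mu_compl : ∀ i, mu i * (S.rate V i - t) = 0
  eps_nonneg : ∀ k, 0 ≤ eps k
  power_le : ∀ k, S.power V k ≤ S.budget k
  eps_compl : ∀ k, eps k * (S.budget k - S.power V k) = 0

/-- The set of the beamformers `V` that are KKT points of (P1) (with some value of the slack
variable `t`). -/
def kktPoints : Set S.Tx := {V | ∃ t mu eps, S.IsKKTWith mu eps t V}

end Network

namespace Matrix

open scoped MatrixOrder Matrix.Norms.L2Operator in
theorem PosDef.exists_eq_conjTranspose_mul_self {n : Type*} [Fintype n] [DecidableEq n]
    {W : Matrix n n ℂ} (hW : W.PosDef) : ∃ B : Matrix n n ℂ, IsUnit B ∧ W = Bᴴ * B := by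
  obtain ⟨B, hB⟩ := CStarAlgebra.nonneg_iff_eq_star_mul_self.1 hW.posSemidef.nonneg
  rw [star_eq_conjTranspose] at hB
  refine ⟨B, ?_, hB⟩
  have h := hW.isUnit
  rw [isUnit_iff_isUnit_det, hB, det_mul] at h
  rw [isUnit_iff_isUnit_det]
  exact isUnit_of_mul_isUnit_right h

theorem PosDef.det_re_pos {n : Type*} [Fintype n] [DecidableEq n]
    {W : Matrix n n ℂ} (hW : W.PosDef) : 0 < W.det.re :=
  (Complex.pos_iff.1 hW.det_pos).1

theorem PosDef.det_eq_re {n : Type*} [Fintype n] [DecidableEq n]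
    {W : Matrix n n ℂ} (hW : W.PosDef) : W.det = (W.det.re : ℂ) :=
  Complex.ext rfl (by simpa using (Complex.pos_iff.1 hW.det_pos).2.symm)

theorem PosDef.trace_mul_re_nonneg {n : Type*} [Fintype n] [DecidableEq n]
    {W X : Matrix n n ℂ} (hW : W.PosDef) (hX : X.PosSemidef) : 0 ≤ (W * X).trace.re := by
  obtain ⟨B, -, rfl⟩ := hW.exists_eq_conjTranspose_mul_self
  rw [mul_assoc, trace_mul_comm]
  exact (Complex.nonneg_iff.1 (hX.mul_mul_conjTranspose_same B).trace_nonneg).1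

theorem PosDef.log_det_le_trace_sub_card {n : Type*} [Fintype n] [DecidableEq n]
    {X : Matrix n n ℂ} (hX : X.PosDef) :
    Real.log X.det.re ≤ X.trace.re - Fintype.card n := by
  rw [hX.isHermitian.det_eq_prod_eigenvalues, hX.isHermitian.trace_eq_sum_eigenvalues]
  have h1 : (∏ i, (hX.isHermitian.eigenvalues i : ℂ)).re = ∏ i, hX.isHermitian.eigenvalues i := by
    rw [← Complex.ofReal_prod, Complex.ofReal_re]
  have h2 : (∑ i, (hX.isHermitian.eigenvalues i : ℂ)).re = ∑ i, hX.isHermitian.eigenvalues i := by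
    rw [← Complex.ofReal_sum, Complex.ofReal_re]
  erw [h1, h2]
  rw [Real.log_prod (fun i _ => (hX.eigenvalues_pos i).ne')]
  have h3 : (Fintype.card n : ℝ) = ∑ _i : n, (1 : ℝ) := by simp
  rw [h3, ← Finset.sum_sub_distrib]
  exact Finset.sum_le_sum fun i _ => Real.log_le_sub_one_of_pos (hX.eigenvalues_pos i)

theorem PosDef.log_det_le_trace_mul_sub {n : Type*} [Fintype n] [DecidableEq n]
    {W X : Matrix n n ℂ} (hW : W.PosDef) (hX : X.PosDef) :
    Real.log X.det.re ≤ (W * X).trace.re - Real.log W.det.re - Fintype.card n := by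
  have hdW := hW.det_re_pos
  have hWre := hW.det_eq_re
  obtain ⟨B, hBu, hB⟩ := hW.exists_eq_conjTranspose_mul_self
  have hM : (B * X * Bᴴ).PosDef :=
    hX.mul_mul_conjTranspose_same (vecMul_injective_iff_isUnit.2 hBu)
  have h := hM.log_det_le_trace_sub_card
  have ht : (B * X * Bᴴ).trace = (W * X).trace := by
    rw [hB, mul_assoc Bᴴ, trace_mul_comm Bᴴ]
  have hd : (B * X * Bᴴ).det = ((W.det.re * X.det.re : ℝ) : ℂ) := by
    rw [Complex.ofReal_mul, ← hWre, ← hX.det_eq_re, hB]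
    simp only [det_mul]
    ring
  rw [ht, hd, Complex.ofReal_re, Real.log_mul hdW.ne' hX.det_re_pos.ne'] at h
  linarith

/-- Completing the square in the mean squared error. -/
theorem mse_eq_add_square {m d : Type*} [Fintype m] [DecidableEq m] [Fintype d] [DecidableEq d]
    {A U : Matrix m d ℂ} {B J : Matrix m m ℂ} (hJ : J.PosDef) (hJB : J = A * Aᴴ + B) :
    (1 - Uᴴ * A) * (1 - Uᴴ * A)ᴴ + Uᴴ * B * U =
      (1 - Aᴴ * (J⁻¹ * A)) + (U - J⁻¹ * A)ᴴ * J * (U - J⁻¹ * A) := by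
  have hu : IsUnit J.det := (isUnit_iff_isUnit_det _).1 hJ.isUnit
  have hi : (J⁻¹)ᴴ = J⁻¹ := hJ.inv.isHermitian
  have hB : B = J - A * Aᴴ := by rw [hJB]; abel
  have h1 : J * (J⁻¹ * A) = A := mul_nonsing_inv_cancel_left _ _ hu
  have h2 : Aᴴ * J⁻¹ * J = Aᴴ := nonsing_inv_mul_cancel_right _ _ hu
  have h3 : (U - J⁻¹ * A)ᴴ * J = Uᴴ * J - Aᴴ := by
    rw [conjTranspose_sub, conjTranspose_mul, hi, Matrix.sub_mul, h2]
  rw [h3, Matrix.mul_sub (Uᴴ * J - Aᴴ), Matrix.sub_mul (Uᴴ * J), Matrix.sub_mul (Uᴴ * J),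
    Matrix.mul_assoc Uᴴ J (J⁻¹ * A), h1, hB]
  simp only [conjTranspose_sub, conjTranspose_one, conjTranspose_mul, conjTranspose_conjTranspose,
    Matrix.mul_sub, Matrix.sub_mul, Matrix.mul_one, Matrix.one_mul, Matrix.mul_assoc]
  abel

theorem det_one_sub_mul_inv_mul {m d : Type*} [Fintype m] [DecidableEq m] [Fintype d]
    [DecidableEq d] {A : Matrix m d ℂ} {B J : Matrix m m ℂ} (hJ : J.PosDef)
    (hJB : J = A * Aᴴ + B) :
    (1 - Aᴴ * (J⁻¹ * A)).det = J.det⁻¹ * B.det := by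
  have hu : IsUnit J.det := (isUnit_iff_isUnit_det _).1 hJ.isUnit
  have h : 1 - J⁻¹ * A * Aᴴ = J⁻¹ * B := by
    have hB : B = J - A * Aᴴ := by rw [hJB]; abel
    rw [hB, Matrix.mul_sub, nonsing_inv_mul _ hu, Matrix.mul_assoc]
  rw [det_one_sub_mul_comm, h, det_mul, det_nonsing_inv, Ring.inverse_eq_inv']

theorem PosDef.one_sub_mul_inv_mul {m d : Type*} [Fintype m] [DecidableEq m] [Fintype d]
    [DecidableEq d] {A : Matrix m d ℂ} {B J : Matrix m m ℂ} (hJ : J.PosDef) (hB : B.PosDef)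
    (hJB : J = A * Aᴴ + B) : (1 - Aᴴ * (J⁻¹ * A)).PosDef := by
  have h : (1 - Aᴴ * (J⁻¹ * A)).PosSemidef := by
    have := mse_eq_add_square (U := J⁻¹ * A) hJ hJB
    rw [sub_self, Matrix.mul_zero, add_zero] at this
    rw [← this]
    exact (posSemidef_self_mul_conjTranspose _).add (hB.posSemidef.conjTranspose_mul_mul_same _)
  rw [h.posDef_iff_det_ne_zero, det_one_sub_mul_inv_mul hJ hJB]
  exact mul_ne_zero (inv_ne_zero hJ.det_pos.ne') hB.det_pos.ne'

theorem det_one_add_mul_inv {m : Type*} [Fintype m] [DecidableEq m] {A B : Matrix m m ℂ}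
    (hB : B.PosDef) : (1 + A * B⁻¹).det = (A + B).det * B.det⁻¹ := by
  have hu : IsUnit B.det := (isUnit_iff_isUnit_det _).1 hB.isUnit
  have h : 1 + A * B⁻¹ = (A + B) * B⁻¹ := by
    rw [Matrix.add_mul, mul_nonsing_inv _ hu, add_comm]
  rw [h, det_mul, det_nonsing_inv, Ring.inverse_eq_inv']

theorem continuousAt_nonsing_inv {α m : Type*} [TopologicalSpace α] [Fintype m] [DecidableEq m]
    {f : α → Matrix m m ℂ} {a : α} (hf : ContinuousAt f a) (h : (f a).det ≠ 0) :
    ContinuousAt (fun x => (f x)⁻¹) a := by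
  simp only [inv_def, Ring.inverse_eq_inv']
  have hd : ContinuousAt (fun x => (f x).det) a :=
    (Continuous.matrix_det continuous_id).continuousAt.comp hf
  have ha : ContinuousAt (fun x => (f x).adjugate) a :=
    (Continuous.matrix_adjugate continuous_id).continuousAt.comp hf
  exact (hd.inv₀ h).smul ha

end Matrix

/-- Gordan's alternative, for finitely many real linear functionals of which only those with
`P a` are constrained. -/
theorem exists_multipliers_of_forall_not_pos {E ι : Type*} [AddCommGroup E] [Module ℝ E]
    [Fintype ι] [DecidableEq ι] (l : ι → E →ₗ[ℝ] ℝ) (P : ι → Prop)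
    (h : ∀ D, ¬ ∀ a, P a → 0 < l a D) :
    ∃ c : ι → ℝ, (∀ a, 0 ≤ c a) ∧ (∀ a, ¬ P a → c a = 0) ∧ 0 < ∑ a, c a ∧
      ∀ D, ∑ a, c a * l a D = 0 := by
  have hopen : IsOpen {y : ι → ℝ | ∀ a, P a → 0 < y a} := by
    simp only [Set.ofPred_forall]
    exact isOpen_iInter_of_finite fun a => isOpen_iInter_of_finite fun _ =>
      isOpen_lt continuous_const (continuous_apply a)
  have hconv : Convex ℝ {y : ι → ℝ | ∀ a, P a → 0 < y a} := by
    simp only [Set.ofPred_forall]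
    exact convex_iInter fun a => convex_iInter fun _ =>
      convex_halfSpace_gt (LinearMap.isLinear (LinearMap.proj (R := ℝ) (φ := fun _ : ι => ℝ) a)) 0
  obtain ⟨f, u, hf, hu⟩ := geometric_hahn_banach_open hconv hopen
    (LinearMap.range (LinearMap.pi l)).convex (by
      rw [Set.disjoint_left]
      rintro _ hy ⟨D, rfl⟩
      exact h D fun a ha => hy a ha)
  have hzero : ∀ D, f (LinearMap.pi l D) = 0 := by
    intro D
    by_contra hne
    have := hu (LinearMap.pi l (((u - 1) / f (LinearMap.pi l D)) • D)) ⟨_, rfl⟩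
    rw [map_smul, map_smul, smul_eq_mul, div_mul_cancel₀ _ hne] at this
    linarith
  have hu0 : u ≤ 0 := by simpa using hu 0 ⟨0, by simp⟩
  have hfsum : ∀ y : ι → ℝ, f y = ∑ a, y a * f (Pi.single a 1) := by
    intro y
    conv_lhs => rw [← Finset.univ_sum_single y, map_sum]
    refine Finset.sum_congr rfl fun a _ => ?_
    rw [← smul_eq_mul, ← map_smul, ← Pi.single_smul, smul_eq_mul, mul_one]
  have hone : f (fun _ => 1) < 0 := (hf _ fun _ _ => one_pos).trans_le hu0
  have hray : ∀ (a : ι) (s : ℝ), (P a → 0 ≤ s) → f (fun _ => 1) + s * f (Pi.single a 1) < 0 := by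
    intro a s hs
    have : f ((fun _ => (1 : ℝ)) + s • Pi.single a 1) < u := by
      refine hf _ fun b hb => ?_
      by_cases hab : b = a
      · subst hab
        have := hs hb
        simp only [Pi.add_apply, Pi.smul_apply, Pi.single_eq_same, smul_eq_mul]
        linarith
      · simp [hab]
    rw [map_add, map_smul, smul_eq_mul] at this
    linarith
  refine ⟨fun a => - f (Pi.single a 1), fun a => ?_, fun a ha => ?_, ?_, fun D => ?_⟩
  · by_contra! hneg
    have := hray a (-f (fun _ => 1) / f (Pi.single a 1)) fun _ => div_nonneg (by linarith) (by linarith)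
    rw [div_mul_cancel₀ _ (by linarith)] at this
    linarith
  · by_contra hne
    have hne' : f (Pi.single a 1) ≠ 0 := fun h => hne (neg_eq_zero.2 h)
    have := hray a (-f (fun _ => 1) / f (Pi.single a 1)) fun h => absurd h ha
    rw [div_mul_cancel₀ _ hne'] at this
    linarith
  · rw [hfsum] at hone
    simpa [Finset.sum_neg_distrib] using hone
  · have := hzero D
    rw [hfsum] at this
    rw [← neg_eq_zero, ← Finset.sum_neg_distrib, ← this]
    refine Finset.sum_congr rfl fun a _ => ?_
    simp only [LinearMap.pi_apply]
    ring

namespace Matrix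

theorem differentiable_mul {E l m n : Type*} [NormedAddCommGroup E] [NormedSpace ℝ E] [Fintype l]
    [Fintype m] [Fintype n] {f : E → Matrix l m ℂ} {g : E → Matrix m n ℂ}
    (hf : Differentiable ℝ f) (hg : Differentiable ℝ g) :
    Differentiable ℝ fun x => f x * g x := by
  have hb : IsBoundedBilinearMap ℝ fun p : Matrix l m ℂ × Matrix m n ℂ => p.1 * p.2 :=
    { add_left := fun _ _ _ => Matrix.add_mul _ _ _
      smul_left := fun _ _ _ => Matrix.smul_mul _ _ _
      add_right := fun _ _ _ => Matrix.mul_add _ _ _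
      smul_right := fun _ _ _ => Matrix.mul_smul _ _ _
      bound := ⟨1, one_pos, fun x y => by simpa using frobenius_norm_mul x y⟩ }
  exact fun x => DifferentiableAt.comp (g := fun p : Matrix l m ℂ × Matrix m n ℂ => p.1 * p.2) x
    (hb.differentiableAt (f x, g x)) ((hf x).prodMk (hg x))

theorem differentiable_linearMap_comp {E F G : Type*} [NormedAddCommGroup E] [NormedSpace ℝ E]
    [NormedAddCommGroup F] [NormedSpace ℝ F] [FiniteDimensional ℝ F] [NormedAddCommGroup G]
    [NormedSpace ℝ G] (L : F →ₗ[ℝ] G) {f : E → F} (hf : Differentiable ℝ f) :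
    Differentiable ℝ fun x => L (f x) :=
  (LinearMap.toContinuousLinearMap L).differentiable.comp hf

theorem differentiable_conjTranspose {E m n : Type*} [NormedAddCommGroup E] [NormedSpace ℝ E]
    [Fintype m] [Fintype n] {f : E → Matrix m n ℂ} (hf : Differentiable ℝ f) :
    Differentiable ℝ fun x => (f x)ᴴ :=
  differentiable_linearMap_comp
    (L := { toFun := conjTranspose, map_add' := conjTranspose_add
            map_smul' := fun c A => by simp [conjTranspose_smul] }) hf

theorem differentiable_trace_re {E m : Type*} [NormedAddCommGroup E] [NormedSpace ℝ E]
    [Fintype m] {f : E → Matrix m m ℂ} (hf : Differentiable ℝ f) :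
    Differentiable ℝ fun x => (f x).trace.re :=
  differentiable_linearMap_comp (Complex.reLm ∘ₗ traceLinearMap m ℝ ℂ) hf

theorem differentiable_det_re {E m : Type*} [NormedAddCommGroup E] [NormedSpace ℝ E]
    [Fintype m] [DecidableEq m] {f : E → Matrix m m ℂ} (hf : Differentiable ℝ f) :
    Differentiable ℝ fun x => (f x).det.re := by
  refine Complex.reCLM.differentiable.comp (f := fun x => (f x).det) ?_
  simp only [det_apply]
  refine Differentiable.fun_sum fun σ _ => Differentiable.const_smul ?_ _
  exact fun x => (HasFDerivAt.finsetProd fun i _ =>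
    (differentiable_linearMap_comp (entryLinearMap ℝ ℂ (σ i) i) hf x).hasFDerivAt).differentiableAt

end Matrix

namespace Network

variable (S : Network)

/-- The norm topology on tuples of beamformers. It agrees with the product topology. -/
noncomputable abbrev txTopology : TopologicalSpace S.Tx :=
  (inferInstance : NormedAddCommGroup S.Tx).toSeminormedAddCommGroup.toPseudoMetricSpace
    |>.toUniformSpace.toTopologicalSpace

attribute [local instance 2000] txTopology

theorem sigCov_posSemidef (V : S.Tx) (i j : S.User) : (S.sigCov V i j).PosSemidef := by
  have := Matrix.posSemidef_self_mul_conjTranspose (S.channel i j.1 * V j)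
  rwa [Matrix.conjTranspose_mul, ← Matrix.mul_assoc] at this

theorem noiseCov_posDef (i : S.User) : (S.noiseCov i).PosDef := by
  refine Matrix.PosDef.one.smul ?_
  rw [← Complex.ofReal_pow]
  exact_mod_cast pow_pos (S.noise_pos i) 2

/-- Covariance of interference plus noise at user `i`. -/
noncomputable def intCov (V : S.Tx) (i : S.User) : Matrix (Fin (S.rxAnt i)) (Fin (S.rxAnt i)) ℂ :=
  S.noiseCov i + ∑ j ∈ Finset.univ.erase i, S.sigCov V i j

/-- Covariance of the received signal at user `i`. -/
noncomputable def rxCov (V : S.Tx) (i : S.User) : Matrix (Fin (S.rxAnt i)) (Fin (S.rxAnt i)) ℂ :=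
  ∑ j, S.sigCov V i j + S.noiseCov i

theorem intCov_posDef (V : S.Tx) (i : S.User) : (S.intCov V i).PosDef :=
  (S.noiseCov_posDef i).add_posSemidef
    (Matrix.posSemidef_sum _ fun j _ => S.sigCov_posSemidef V i j)

theorem rxCov_posDef (V : S.Tx) (i : S.User) : (S.rxCov V i).PosDef :=
  Matrix.PosDef.posSemidef_add (Matrix.posSemidef_sum _ fun j _ => S.sigCov_posSemidef V i j)
    (S.noiseCov_posDef i)

theorem rxCov_eq_sigCov_add (V : S.Tx) (i : S.User) :
    S.rxCov V i = S.sigCov V i i + S.intCov V i := by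
  rw [rxCov, intCov, ← Finset.add_sum_erase _ _ (Finset.mem_univ i)]
  abel

theorem rxCov_eq (V : S.Tx) (i : S.User) :
    S.rxCov V i = (S.channel i i.1 * V i) * (S.channel i i.1 * V i)ᴴ + S.intCov V i := by
  rw [rxCov_eq_sigCov_add, sigCov, Matrix.conjTranspose_mul, ← Matrix.mul_assoc]

theorem rate_eq (V : S.Tx) (i : S.User) :
    S.rate V i = Real.log (S.rxCov V i).det.re - Real.log (S.intCov V i).det.re := by
  have hJ := S.rxCov_posDef V i
  have hB := S.intCov_posDef V i
  change Real.log (1 + S.sigCov V i i * (S.intCov V i)⁻¹).det.re = _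
  rw [Matrix.det_one_add_mul_inv hB, ← rxCov_eq_sigCov_add, hJ.det_eq_re, hB.det_eq_re,
    ← Complex.ofReal_inv, ← Complex.ofReal_mul]
  simp only [Complex.ofReal_re]
  rw [Real.log_mul hJ.det_re_pos.ne' (inv_ne_zero hB.det_re_pos.ne'), Real.log_inv, sub_eq_add_neg]

/-- The mean squared error matrix of user `i` under the MMSE receiver. -/
noncomputable def minMse (V : S.Tx) (i : S.User) :
    Matrix (Fin (S.streams i)) (Fin (S.streams i)) ℂ :=
  1 - (S.channel i i.1 * V i)ᴴ * ((S.rxCov V i)⁻¹ * (S.channel i i.1 * V i))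

theorem minMse_posDef (V : S.Tx) (i : S.User) : (S.minMse V i).PosDef :=
  (S.rxCov_posDef V i).one_sub_mul_inv_mul (S.intCov_posDef V i) (S.rxCov_eq V i)

theorem log_det_minMse (V : S.Tx) (i : S.User) :
    Real.log (S.minMse V i).det.re = - S.rate V i := by
  have hJ := S.rxCov_posDef V i
  have hB := S.intCov_posDef V i
  rw [minMse, Matrix.det_one_sub_mul_inv_mul hJ (S.rxCov_eq V i), rate_eq, hJ.det_eq_re,
    hB.det_eq_re, ← Complex.ofReal_inv, ← Complex.ofReal_mul]
  simp only [Complex.ofReal_re]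
  rw [Real.log_mul (inv_ne_zero hJ.det_re_pos.ne') hB.det_re_pos.ne', Real.log_inv]
  ring

theorem mmse_eq (V : S.Tx) (i : S.User) :
    S.mmse V i = (S.rxCov V i)⁻¹ * (S.channel i i.1 * V i) := by
  rw [mmse, rxCov, Matrix.mul_assoc]

theorem invMse_eq (V : S.Tx) (i : S.User) : S.invMse V i = (S.minMse V i)⁻¹ := by
  rw [invMse, minMse, mmse_eq, Matrix.conjTranspose_mul]

theorem invMse_posDef (V : S.Tx) (i : S.User) : (S.invMse V i).PosDef := by
  rw [invMse_eq]
  exact (S.minMse_posDef V i).inv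

theorem mse_eq (U : S.Rx) (V : S.Tx) (i : S.User) :
    S.mse U V i = S.minMse V i + (U i - S.mmse V i)ᴴ * S.rxCov V i * (U i - S.mmse V i) := by
  rw [mmse_eq, minMse, ← Matrix.mse_eq_add_square (S.rxCov_posDef V i) (S.rxCov_eq V i), mse,
    intCov, noiseCov, Matrix.mul_add, Matrix.add_mul, Matrix.mul_sum, Matrix.sum_mul,
    Matrix.mul_smul, Matrix.smul_mul, Matrix.mul_one]
  simp only [Matrix.mul_assoc]
  abel

/-- The weighted mean squared error term `Tr (W_i E_i(U_i, V)) - log det W_i - d_i` of user `i`. -/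
noncomputable def wmse (U : S.Rx) (W : S.Weights) (V : S.Tx) (i : S.User) : ℝ :=
  (W i * S.mse U V i).trace.re - Real.log (W i).det.re - (S.streams i : ℝ)

theorem neg_rate_le_wmse {U : S.Rx} {W : S.Weights} (V : S.Tx) {i : S.User}
    (hW : (W i).PosDef) : - S.rate V i ≤ S.wmse U W V i := by
  have h1 := hW.log_det_le_trace_mul_sub (S.minMse_posDef V i)
  have h2 := hW.trace_mul_re_nonneg
    ((S.rxCov_posDef V i).posSemidef.conjTranspose_mul_mul_same (U i - S.mmse V i))
  rw [log_det_minMse, Fintype.card_fin] at h1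
  rw [wmse, mse_eq, Matrix.mul_add, Matrix.trace_add, Complex.add_re]
  linarith

theorem wmse_mmse_invMse (V : S.Tx) (i : S.User) :
    S.wmse (S.mmse V) (S.invMse V) V i = - S.rate V i := by
  have hE := S.minMse_posDef V i
  have hu : IsUnit (S.minMse V i).det := (Matrix.isUnit_iff_isUnit_det _).1 hE.isUnit
  rw [wmse, mse_eq, sub_self, Matrix.mul_zero, add_zero, invMse_eq, Matrix.nonsing_inv_mul _ hu,
    Matrix.trace_one, Matrix.det_nonsing_inv, Ring.inverse_eq_inv', hE.det_eq_re,
    ← Complex.ofReal_inv, Complex.ofReal_re, Real.log_inv, log_det_minMse]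
  simp

theorem differentiable_coord (j : S.User) : Differentiable ℝ fun V : S.Tx => V j :=
  (PiLp.proj (𝕜 := ℝ) 2 (fun i : S.User => Matrix (Fin (S.txAnt i.1)) (Fin (S.streams i)) ℂ)
    j).differentiable

theorem differentiable_sigCov (i j : S.User) : Differentiable ℝ fun V => S.sigCov V i j :=
  Matrix.differentiable_mul (Matrix.differentiable_mul (Matrix.differentiable_mul
    (differentiable_const _) (S.differentiable_coord j))
    (Matrix.differentiable_conjTranspose (S.differentiable_coord j))) (differentiable_const _)

theorem differentiable_intCov (i : S.User) : Differentiable ℝ fun V => S.intCov V i :=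
  (Differentiable.fun_sum fun j _ => S.differentiable_sigCov i j).const_add _

theorem differentiable_rxCov (i : S.User) : Differentiable ℝ fun V => S.rxCov V i :=
  (Differentiable.fun_sum fun j _ => S.differentiable_sigCov i j).add_const _

theorem differentiable_rate (i : S.User) : Differentiable ℝ fun V => S.rate V i := by
  simp only [rate_eq]
  exact ((Matrix.differentiable_det_re (S.differentiable_rxCov i)).log fun V =>
    (S.rxCov_posDef V i).det_re_pos.ne').sub
    ((Matrix.differentiable_det_re (S.differentiable_intCov i)).log fun V =>
      (S.intCov_posDef V i).det_re_pos.ne')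

theorem differentiable_power (k : Fin S.numCells) : Differentiable ℝ fun V => S.power V k :=
  Differentiable.fun_sum fun i _ => Matrix.differentiable_trace_re
    (Matrix.differentiable_mul (S.differentiable_coord ⟨k, i⟩)
      (Matrix.differentiable_conjTranspose (S.differentiable_coord ⟨k, i⟩)))

theorem differentiable_wmse (U : S.Rx) (W : S.Weights) (i : S.User) :
    Differentiable ℝ fun V => S.wmse U W V i := by
  have h1 : Differentiable ℝ fun V : S.Tx => 1 - (U i)ᴴ * S.channel i i.1 * V i :=
    (Matrix.differentiable_mul (differentiable_const _) (S.differentiable_coord i)).const_sub _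
  have h2 : Differentiable ℝ fun V : S.Tx => S.mse U V i :=
    ((Matrix.differentiable_mul h1 (Matrix.differentiable_conjTranspose h1)).add
      (Differentiable.fun_sum fun j _ => Matrix.differentiable_mul (Matrix.differentiable_mul
        (differentiable_const _) (S.differentiable_sigCov i j)) (differentiable_const _))).add_const _
  exact ((Matrix.differentiable_trace_re
    (Matrix.differentiable_mul (differentiable_const _) h2)).sub_const _).sub_const _

theorem continuous_mmse (i : S.User) : Continuous fun V => S.mmse V i := by
  simp only [mmse_eq]
  refine Continuous.matrix_mul (continuous_iff_continuousAt.2 fun V => ?_)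
    (continuous_const.matrix_mul (S.differentiable_coord i).continuous)
  exact Matrix.continuousAt_nonsing_inv (S.differentiable_rxCov i).continuous.continuousAt
    (S.rxCov_posDef V i).det_pos.ne'

theorem continuous_invMse (i : S.User) : Continuous fun V => S.invMse V i := by
  have h : Continuous fun V => S.minMse V i := by
    have hA : Continuous fun V : S.Tx => S.channel i i.1 * V i :=
      continuous_const.matrix_mul (S.differentiable_coord i).continuous
    have hm := S.continuous_mmse i
    simp only [mmse_eq] at hm
    exact continuous_const.sub (hA.matrix_conjTranspose.matrix_mul hm)
  simp only [invMse_eq]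
  exact continuous_iff_continuousAt.2 fun V => Matrix.continuousAt_nonsing_inv h.continuousAt
    (S.minMse_posDef V i).det_pos.ne'

theorem continuous_wmse_mmse_invMse (V : S.Tx) (i : S.User) :
    Continuous fun V' => S.wmse (S.mmse V') (S.invMse V') V i := by
  have hU := S.continuous_mmse i
  have hW := S.continuous_invMse i
  have h1 : Continuous fun V' => 1 - (S.mmse V' i)ᴴ * S.channel i i.1 * V i :=
    continuous_const.sub ((hU.matrix_conjTranspose.matrix_mul continuous_const).matrix_mul
      continuous_const)
  have h2 : Continuous fun V' => S.mse (S.mmse V') V i :=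
    ((h1.matrix_mul h1.matrix_conjTranspose).add (continuous_finsetSum _ fun j _ =>
      (hU.matrix_conjTranspose.matrix_mul continuous_const).matrix_mul hU)).add
      (Continuous.const_smul (hU.matrix_conjTranspose.matrix_mul hU) ((S.noise i : ℂ) ^ 2))
  refine ((Complex.continuous_re.comp (hW.matrix_mul h2).matrix_trace).sub ?_).sub continuous_const
  exact (Complex.continuous_re.comp hW.matrix_det).log fun V' =>
    (S.invMse_posDef V' i).det_re_pos.ne'

end Network

theorem HasDerivAt.eventually_lt_nhdsGT {g : ℝ → ℝ} {g' x : ℝ} (hg : HasDerivAt g g' x)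
    (h : g' < 0) : ∀ᶠ s in 𝓝[>] x, g s < g x := by
  have h1 : ∀ᶠ s in 𝓝[>] x, slope g x s < 0 :=
    (hasDerivAt_iff_tendsto_slope.1 hg).mono_left
      (nhdsWithin_mono _ fun _ hs => ne_of_gt hs) |>.eventually_lt_const h
  filter_upwards [h1, self_mem_nhdsWithin] with s hs hxs
  have hxs' : 0 < s - x := sub_pos.2 hxs
  rw [slope_def_field, div_neg_iff] at hs
  rcases hs with hs | hs <;> linarith [hs.1, hs.2]

theorem Matrix.trace_mul_conjTranspose_re {m n : Type*} [Fintype m] [Fintype n]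
    (A : Matrix m n ℂ) : (A * Aᴴ).trace.re = ‖A‖ ^ 2 := by
  rw [frobenius_norm_def, ← Real.sqrt_eq_rpow, Real.sq_sqrt (by positivity)]
  simp only [trace, diag_apply, mul_apply, conjTranspose_apply, Complex.re_sum]
  refine Finset.sum_congr rfl fun i _ => Finset.sum_congr rfl fun j _ => ?_
  rw [RCLike.star_def, Complex.mul_conj, Complex.ofReal_re, Complex.normSq_eq_norm_sq]
  norm_num

namespace Network

variable (S : Network)

attribute [local instance 2000] txTopology

theorem power_eq (V : S.Tx) (k : Fin S.numCells) : S.power V k = ∑ i, ‖V ⟨k, i⟩‖ ^ 2 :=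
  Finset.sum_congr rfl fun _ _ => Matrix.trace_mul_conjTranspose_re _

theorem power_nonneg (V : S.Tx) (k : Fin S.numCells) : 0 ≤ S.power V k := by
  rw [power_eq]
  positivity

theorem power_smul (c : ℝ) (V : S.Tx) (k : Fin S.numCells) :
    S.power (c • V) k = c ^ 2 * S.power V k := by
  simp only [power_eq, Finset.mul_sum]
  refine Finset.sum_congr rfl fun i _ => ?_
  rw [PiLp.smul_apply, norm_smul, mul_pow, Real.norm_eq_abs, sq_abs]

theorem eq_zero_of_power_eq_zero {V : S.Tx} {k : Fin S.numCells} (h : S.power V k = 0)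
    (i : Fin (S.numUsers k)) : V ⟨k, i⟩ = 0 := by
  rw [power_eq, Finset.sum_eq_zero_iff_of_nonneg fun _ _ => by positivity] at h
  simpa using h i (Finset.mem_univ i)

theorem isCompact_feasible : IsCompact S.feasible := by
  have : ProperSpace S.Tx := FiniteDimensional.proper_real _
  have hclosed : IsClosed S.feasible := by
    simp only [feasible, Set.ofPred_forall]
    exact isClosed_iInter fun k =>
      isClosed_le (S.differentiable_power k).continuous continuous_const
  refine (isCompact_closedBall (0 : S.Tx) √(∑ k, S.budget k)).of_isClosed_subset hclosed
    fun V hV => ?_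
  rw [mem_closedBall_zero_iff]
  apply Real.le_sqrt_of_sq_le
  rw [PiLp.norm_sq_eq_of_L2, Fintype.sum_sigma]
  refine Finset.sum_le_sum fun k _ => ?_
  rw [← power_eq]
  exact hV k

variable {S} in
theorem rate_congr {V V' : S.Tx} (h : ∀ j, V j * (V j)ᴴ = V' j * (V' j)ᴴ) (i : S.User) :
    S.rate V i = S.rate V' i := by
  have hs : ∀ j, S.sigCov V i j = S.sigCov V' i j := fun j => by
    simp only [sigCov, Matrix.mul_assoc (S.channel i j.1), h]
  simp only [rate, hs]

theorem hasDerivAt_line (V D : S.Tx) : HasDerivAt (fun s : ℝ => V + s • D) D 0 := by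
  simpa using ((hasDerivAt_id (0 : ℝ)).smul_const D).const_add V

theorem hasDerivAt_comp_line {f : S.Tx → ℝ} (hf : Differentiable ℝ f) (V D : S.Tx) :
    HasDerivAt (fun s : ℝ => f (V + s • D)) (fderiv ℝ f V D) 0 := by
  have h : HasFDerivAt f (fderiv ℝ f V) (V + (0 : ℝ) • D) := by
    rw [zero_smul, add_zero]
    exact (hf V).hasFDerivAt
  exact h.comp_hasDerivAt 0 (S.hasDerivAt_line V D)

/-- The rates are even in each beamformer, so their derivative at a point vanishes in directions
in which the point has no component. -/
theorem fderiv_rate_eq_zero {V Z : S.Tx} (h : ∀ j, V j = 0 ∨ Z j = 0) (i : S.User) :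
    fderiv ℝ (fun V => S.rate V i) V Z = 0 := by
  have hd := S.hasDerivAt_comp_line (S.differentiable_rate i) V Z
  have hd' := S.hasDerivAt_comp_line (S.differentiable_rate i) V (-Z)
  have he : (fun s : ℝ => S.rate (V + s • -Z) i) = fun s : ℝ => S.rate (V + s • Z) i := by
    funext s
    refine rate_congr (fun j => ?_) i
    rcases h j with h | h <;> simp [h]
  rw [he, map_neg] at hd'
  linarith [hd.unique hd']

theorem fderiv_power_self (V : S.Tx) (k : Fin S.numCells) :
    fderiv ℝ (fun V => S.power V k) V V = 2 * S.power V k := by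
  have hd := S.hasDerivAt_comp_line (S.differentiable_power k) V V
  have he : (fun s : ℝ => S.power (V + s • V) k) = fun s : ℝ => (1 + s) ^ 2 * S.power V k := by
    funext s
    rw [← power_smul, add_smul, one_smul]
  rw [he] at hd
  have h2 : HasDerivAt (fun s : ℝ => (1 + s) ^ 2 * S.power V k) (2 * S.power V k) 0 := by
    simpa using (((hasDerivAt_id (0 : ℝ)).const_add 1).pow 2).mul_const (S.power V k)
  exact hd.unique h2

theorem fderiv_wmse_eq_neg (V : S.Tx) (i : S.User) :
    fderiv ℝ (fun V' => S.wmse (S.mmse V) (S.invMse V) V' i) V =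
      - fderiv ℝ (fun V' => S.rate V' i) V := by
  have hw := (S.differentiable_wmse (S.mmse V) (S.invMse V) i V).hasFDerivAt
  have hr := (S.differentiable_rate i V).hasFDerivAt
  have hmin : IsLocalMin (fun V' => S.wmse (S.mmse V) (S.invMse V) V' i + S.rate V' i) V := by
    refine Eventually.of_forall fun V' => ?_
    have := S.neg_rate_le_wmse (U := S.mmse V) V' (S.invMse_posDef V i)
    simp only [wmse_mmse_invMse]
    linarith
  exact eq_neg_of_add_eq_zero_left (hmin.hasFDerivAt_eq_zero (hw.add hr))

/-- A feasible point that minimizes its own surrogate objective is a KKT point. -/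
theorem mem_kktPoints_of_le_objective [Nonempty S.User] {V : S.Tx} (hV : V ∈ S.feasible)
    (hmin : ∀ V' ∈ S.feasible,
      ⨆ i, - S.rate V i ≤ S.objective (S.mmse V) (S.invMse V) V') : V ∈ S.kktPoints := by
  classical
  set φ := ⨆ i, - S.rate V i
  have hle : ∀ i, -φ ≤ S.rate V i := fun i => by
    have := le_ciSup (Set.finite_range fun i => - S.rate V i).bddAbove i
    linarith
  have hbud : ∀ k, 0 ≤ S.budget k := fun k => (S.power_nonneg V k).trans (hV k)
  let R : S.User → S.Tx →L[ℝ] ℝ := fun i => fderiv ℝ (fun V => S.rate V i) V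
  let Q : Fin S.numCells → S.Tx →L[ℝ] ℝ := fun k => fderiv ℝ (fun V => S.power V k) V
  obtain ⟨c, hc0, hcP, hcpos, hc⟩ := exists_multipliers_of_forall_not_pos
    (Sum.elim (fun i => (R i : S.Tx →ₗ[ℝ] ℝ)) (fun k => -(Q k : S.Tx →ₗ[ℝ] ℝ)))
    (Sum.elim (fun i => S.rate V i = -φ) (fun k => S.budget k ≠ 0 ∧ S.power V k = S.budget k)) (by
      intro D hD
      have hDR : ∀ i, S.rate V i = -φ → 0 < R i D := fun i hi => hD (Sum.inl i) hi
      have hDQ : ∀ k, S.budget k ≠ 0 → S.power V k = S.budget k → Q k D < 0 := fun k hk hk' =>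
        neg_pos.1 (hD (Sum.inr k) ⟨hk, hk'⟩)
      let D' : S.Tx := WithLp.toLp 2 fun j => if S.budget j.1 = 0 then 0 else D j
      have hD' : ∀ j, D' j = if S.budget j.1 = 0 then 0 else D j := fun _ => rfl
      have hRD' : ∀ i, R i D' = R i D := fun i => by
        rw [← sub_eq_zero, ← map_sub]
        refine S.fderiv_rate_eq_zero (fun j => ?_) i
        by_cases hj : S.budget j.1 = 0
        · left
          exact S.eq_zero_of_power_eq_zero
            (le_antisymm ((hV j.1).trans hj.le) (S.power_nonneg V j.1)) j.2
        · right
          rw [PiLp.sub_apply, hD', if_neg hj, sub_self]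
      have hfeas : ∀ k, ∀ᶠ s in 𝓝[>] (0 : ℝ), S.power (V + s • D') k ≤ S.budget k := by
        intro k
        by_cases hk : S.budget k = 0
        · refine Eventually.of_forall fun s => ?_
          have h0 : S.power V k = 0 := le_antisymm ((hV k).trans hk.le) (S.power_nonneg V k)
          rw [power_eq, hk]
          refine (Finset.sum_eq_zero fun i _ => ?_).le
          rw [PiLp.add_apply, PiLp.smul_apply, S.eq_zero_of_power_eq_zero h0, hD', if_pos hk]
          simp
        · have he : ∀ s : ℝ, S.power (V + s • D') k = S.power (V + s • D) k := fun s => by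
            simp only [power_eq, PiLp.add_apply, PiLp.smul_apply, hD', if_neg hk]
          simp only [he]
          have hd := S.hasDerivAt_comp_line (S.differentiable_power k) V D
          rcases (hV k).lt_or_eq with hlt | heq
          · have := hd.continuousAt.tendsto.mono_left (nhdsWithin_le_nhds (s := Set.Ioi 0))
            simp only [zero_smul, add_zero] at this
            exact (this.eventually_lt_const hlt).mono fun s hs => hs.le
          · filter_upwards [hd.eventually_lt_nhdsGT (hDQ k hk heq)] with s hs
            simp only [zero_smul, add_zero] at hs
            exact hs.le.trans heq.le
      have hdec : ∀ i, ∀ᶠ s in 𝓝[>] (0 : ℝ),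
          S.wmse (S.mmse V) (S.invMse V) (V + s • D') i < φ := by
        intro i
        have hd := S.hasDerivAt_comp_line (S.differentiable_wmse (S.mmse V) (S.invMse V) i) V D'
        rcases (hle i).lt_or_eq with hlt | heq
        · have := hd.continuousAt.tendsto.mono_left (nhdsWithin_le_nhds (s := Set.Ioi 0))
          simp only [zero_smul, add_zero, wmse_mmse_invMse] at this
          exact this.eventually_lt_const (by linarith)
        · have hneg : fderiv ℝ (fun V' => S.wmse (S.mmse V) (S.invMse V) V' i) V D' < 0 := by
            rw [fderiv_wmse_eq_neg]
            have := hDR i heq.symm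
            rw [← hRD'] at this
            exact neg_neg_of_pos this
          filter_upwards [hd.eventually_lt_nhdsGT hneg] with s hs
          simp only [zero_smul, add_zero, wmse_mmse_invMse] at hs
          linarith
      obtain ⟨s, hs1, hs2⟩ := ((eventually_all.2 hfeas).and (eventually_all.2 hdec)).exists
      obtain ⟨i, hi⟩ := exists_eq_ciSup_of_finite
        (f := fun i => S.wmse (S.mmse V) (S.invMse V) (V + s • D') i)
      have := hmin _ hs1
      change φ ≤ ⨆ i, S.wmse (S.mmse V) (S.invMse V) (V + s • D') i at this
      rw [← hi] at this
      exact absurd (hs2 i) this.not_gt)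
  have hstat : ∀ D, ∑ i, c (Sum.inl i) * R i D - ∑ k, c (Sum.inr k) * Q k D = 0 := fun D => by
    have := hc D
    rw [Fintype.sum_sum_type] at this
    simpa [Finset.sum_neg_distrib, sub_eq_add_neg] using this
  set M := ∑ i, c (Sum.inl i) with hM
  have hMpos : 0 < M := by
    refine (Finset.sum_nonneg fun i _ => hc0 _).lt_of_ne fun h0 => ?_
    have hmu : ∀ i, c (Sum.inl i) = 0 := fun i =>
      (Finset.sum_eq_zero_iff_of_nonneg fun i _ => hc0 (Sum.inl i)).1 h0.symm i (Finset.mem_univ i)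
    have hs := hstat V
    simp only [hmu, zero_mul, Finset.sum_const_zero, zero_sub, neg_eq_zero] at hs
    have hnn : ∀ k, 0 ≤ c (Sum.inr k) * Q k V := fun k => by
      have : Q k V = 2 * S.power V k := S.fderiv_power_self V k
      rw [this]
      exact mul_nonneg (hc0 _) (mul_nonneg zero_le_two (S.power_nonneg V k))
    have heps : ∀ k, c (Sum.inr k) = 0 := fun k => by
      by_contra hne
      have hk := (Finset.sum_eq_zero_iff_of_nonneg fun k _ => hnn k).1 hs k (Finset.mem_univ k)
      have hP : S.budget k ≠ 0 ∧ S.power V k = S.budget k := by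
        by_contra hP
        exact hne (hcP (Sum.inr k) hP)
      have : Q k V = 2 * S.power V k := S.fderiv_power_self V k
      rw [this, hP.2] at hk
      rcases mul_eq_zero.1 hk with h | h
      · exact hne h
      · exact hP.1 (by linarith)
    rw [Fintype.sum_sum_type] at hcpos
    simp [hmu, heps] at hcpos
  refine ⟨-φ, fun i => c (Sum.inl i) / M, fun k => c (Sum.inr k) / M, ?_, ?_, ?_, hle, ?_, ?_, hV, ?_⟩
  · have hR : ∀ i, HasFDerivAt (fun V => S.rate V i) (R i) V := fun i =>
      (S.differentiable_rate i V).hasFDerivAt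
    have hQ : ∀ k, HasFDerivAt (fun V => S.power V k) (Q k) V := fun k =>
      (S.differentiable_power k V).hasFDerivAt
    have hL := ((HasFDerivAt.fun_sum (u := Finset.univ) fun i _ =>
      ((hR i).sub_const (-φ)).const_mul (c (Sum.inl i) / M)).const_add (-φ)).add
      (HasFDerivAt.fun_sum (u := Finset.univ) fun k _ =>
        ((hQ k).const_sub (S.budget k)).const_mul (c (Sum.inr k) / M))
    have hz : ∑ i, (c (Sum.inl i) / M) • R i + ∑ k, (c (Sum.inr k) / M) • -Q k = 0 := by
      ext D
      have := hstat D
      simp only [add_apply, sum_apply,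
        smul_apply, neg_apply, smul_eq_mul,
        zero_apply, mul_neg, Finset.sum_neg_distrib, div_mul_eq_mul_div,
        ← Finset.sum_div]
      rw [← sub_eq_add_neg, ← sub_div, this, zero_div]
    rw [hz] at hL
    exact hL
  · rw [← Finset.sum_div, ← hM, div_self hMpos.ne']
  · exact fun i => div_nonneg (hc0 _) hMpos.le
  · intro i
    by_cases hi : S.rate V i = -φ
    · rw [hi, sub_self, mul_zero]
    · rw [hcP (Sum.inl i) hi, zero_div, zero_mul]
  · exact fun k => div_nonneg (hc0 _) hMpos.le
  · intro k
    by_cases hk : S.power V k = S.budget k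
    · rw [hk, sub_self, mul_zero]
    · rw [hcP (Sum.inr k) fun h => hk h.2, zero_div, zero_mul]

end Network

theorem continuous_iSup_of_finite {α ι : Type*} [TopologicalSpace α] [Finite ι] [Nonempty ι]
    {f : ι → α → ℝ} (hf : ∀ i, Continuous (f i)) : Continuous fun x => ⨆ i, f i x := by
  have := Fintype.ofFinite ι
  simp only [← Finset.sup'_univ_eq_ciSup]
  exact Continuous.finset_sup'_apply _ fun i _ => hf i

/-- If every cluster point of a sequence in a compact set lies in `T`, then the distance to `T`
tends to zero. -/
theorem tendsto_infDist_of_mapClusterPt {E : Type*} [PseudoMetricSpace E] {K T : Set E}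
    {u : ℕ → E} (hK : IsCompact K) (hu : ∀ᶠ n in atTop, u n ∈ K)
    (h : ∀ x, MapClusterPt x atTop u → x ∈ T) :
    Tendsto (fun n => Metric.infDist (u n) T) atTop (𝓝 0) := by
  refine tendsto_order.2 ⟨fun a ha => Eventually.of_forall fun n => ha.trans_le
    Metric.infDist_nonneg, fun a ha => ?_⟩
  by_contra hfreq
  rw [not_eventually] at hfreq
  have hK' : IsCompact (K ∩ {x | a ≤ Metric.infDist x T}) :=
    hK.inter_right (isClosed_le continuous_const (Metric.continuous_infDist_pt T))
  obtain ⟨x, hx, hxc⟩ := hK'.exists_mapClusterPt_of_frequently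
    ((hfreq.and_eventually hu).mono fun n hn => ⟨hn.2, not_lt.1 hn.1⟩)
  have := Metric.infDist_zero_of_mem (h x hxc)
  have hx2 : a ≤ Metric.infDist x T := hx.2
  linarith

theorem MapClusterPt.mem_of_isClosed {E : Type*} [TopologicalSpace E] {T : Set E} {u : ℕ → E}
    {x : E} (hx : MapClusterPt x atTop u) (hT : IsClosed T) (hu : ∀ᶠ n in atTop, u n ∈ T) :
    x ∈ T :=
  hT.closure_subset (mem_closure_iff_clusterPt.2 (ClusterPt.mono hx (le_principal_iff.2 hu)))

namespace Network

variable {S : Network} {V : ℕ → S.Tx} {U : ℕ → S.Rx} {W : ℕ → S.Weights}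

attribute [local instance 2000] txTopology

theorem iSup_neg_rate_le_objective [Nonempty S.User] (U : S.Rx) {W : S.Weights}
    (hW : ∀ i, (W i).PosDef) (V : S.Tx) : ⨆ i, - S.rate V i ≤ S.objective U W V :=
  ciSup_mono (Set.finite_range _).bddAbove fun i => S.neg_rate_le_wmse V (hW i)

theorem objective_mmse_invMse (V : S.Tx) :
    S.objective (S.mmse V) (S.invMse V) V = ⨆ i, - S.rate V i :=
  iSup_congr fun i => S.wmse_mmse_invMse V i

theorem continuous_iSup_neg_rate [Nonempty S.User] : Continuous fun V => ⨆ i, - S.rate V i :=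
  continuous_iSup_of_finite fun i => (S.differentiable_rate i).continuous.neg

theorem continuous_objective_mmse_invMse [Nonempty S.User] (V : S.Tx) :
    Continuous fun V' => S.objective (S.mmse V') (S.invMse V') V :=
  continuous_iSup_of_finite fun i => S.continuous_wmse_mmse_invMse V i

namespace IsRun

theorem feasible (h : S.IsRun V U W) (n : ℕ) : V n ∈ S.feasible := by
  cases n with
  | zero => exact h.init_feasible
  | succ n => exact (h.step_V n).1

theorem iSup_neg_rate_le [Nonempty S.User] (h : S.IsRun V U W) (n : ℕ) {V' : S.Tx}
    (hV' : V' ∈ S.feasible) :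
    ⨆ i, - S.rate (V (n + 2)) i ≤
      S.objective (S.mmse (V (n + 1))) (S.invMse (V (n + 1))) V' := by
  have hmin := (h.step_V (n + 1)).2
  rw [h.step_U, h.step_W] at hmin
  exact (iSup_neg_rate_le_objective _ (S.invMse_posDef (V (n + 1))) _).trans (hmin hV')

theorem antitone_iSup_neg_rate [Nonempty S.User] (h : S.IsRun V U W) :
    Antitone fun n => ⨆ i, - S.rate (V (n + 1)) i :=
  antitone_nat_of_succ_le fun n =>
    (h.iSup_neg_rate_le n (h.feasible (n + 1))).trans_eq (objective_mmse_invMse _)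

theorem mem_kktPoints_of_mapClusterPt [Nonempty S.User] (h : S.IsRun V U W) {x : S.Tx}
    (hx : MapClusterPt x atTop V) : x ∈ S.kktPoints := by
  have hle : ∀ m, ⨆ i, - S.rate x i ≤ ⨆ i, - S.rate (V (m + 1)) i := by
    intro m
    refine hx.mem_of_isClosed
      (T := {y | ⨆ i, - S.rate y i ≤ ⨆ i, - S.rate (V (m + 1)) i})
      (isClosed_le continuous_iSup_neg_rate continuous_const) ?_
    filter_upwards [eventually_ge_atTop (m + 1)] with n hn
    obtain ⟨l, rfl⟩ := Nat.exists_eq_add_of_le' (Nat.le_of_add_left_le hn)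
    exact h.antitone_iSup_neg_rate (Nat.le_of_add_le_add_right hn)
  refine S.mem_kktPoints_of_le_objective
    (hx.mem_of_isClosed S.isCompact_feasible.isClosed (Eventually.of_forall h.feasible))
    fun V' hV' => ?_
  refine hx.mem_of_isClosed
    (T := {y | ⨆ i, - S.rate x i ≤ S.objective (S.mmse y) (S.invMse y) V'})
    (isClosed_le continuous_const (continuous_objective_mmse_invMse V')) ?_
  filter_upwards [eventually_ge_atTop 1] with n hn
  obtain ⟨l, rfl⟩ := Nat.exists_eq_add_of_le' hn
  exact (hle (l + 1)).trans (h.iSup_neg_rate_le l hV')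

theorem kktPoints_nonempty [Nonempty S.User] (h : S.IsRun V U W) : S.kktPoints.Nonempty := by
  obtain ⟨x, -, hx⟩ := S.isCompact_feasible.exists_mapClusterPt_of_frequently
    (Frequently.of_forall h.feasible : ∃ᶠ n in atTop, V n ∈ S.feasible)
  exact ⟨x, h.mem_kktPoints_of_mapClusterPt hx⟩

theorem tendsto_infDist_kktPoints [Nonempty S.User] (h : S.IsRun V U W) :
    Tendsto (fun n => Metric.infDist (V n) S.kktPoints) atTop (𝓝 0) :=
  tendsto_infDist_of_mapClusterPt S.isCompact_feasible (Eventually.of_forall h.feasible)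
    fun _ hx => h.mem_kktPoints_of_mapClusterPt hx

end IsRun

end Network

theorem theorem2 (S : Network) (hS : Nonempty S.User)
    (V : ℕ → S.Tx) (U : ℕ → S.Rx) (W : ℕ → S.Weights) (hrun : S.IsRun V U W) :
    S.kktPoints.Nonempty ∧
      Tendsto (fun n => Metric.infDist (V n) S.kktPoints) atTop (𝓝 0) ∧
      ∀ Vbar : S.Tx, MapClusterPt Vbar atTop V → Vbar ∈ S.kktPoints :=
  ⟨hrun.kktPoints_nonempty, hrun.tendsto_infDist_kktPoints,
    fun _ hx => hrun.mem_kktPoints_of_mapClusterPt hx⟩
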